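/- **Definitions.** A *web diagram* on $n$ pegs is a finite set $D$ of 4-tuples (edges) $(x,y,a,b)$ with $1\le x<y\le n$ (the edge joins height $a$ on peg $x$ to height $b$ on peg $y$) such that for every peg $i$ the set of heights occurring on peg $i$ is $\{1,\dots,p_i(D)\}$, where $p_i(D)$ is the number of edges of $D$ incident with peg $i$. The *web world* $W(D)$ is the set of all diagrams obtained from $D$ by permuting, on each peg $i$, the heights $1,\dots,p_i(D)$. The *sum* $D\oplus D'$ places $D'$ on top of $D$: $D\oplus D'=D\cup\{(x,y,a+p_x(D),b+p_y(D)):(x,y,a,b)\in D'\}$. A non-empty web diagram is *indecomposable* if it is not the sum of two non-empty web diagrams. For $X\subseteq D$, $\mathrm{rel}(X)$ is the web diagram obtained from $X$ by relabelling the heights on each peg by $1,2,\dots$, keeping their order. An *$\ell$-colouring* of $D$ is a surjection $c$ from the edges of $D$ onto $\{1,\dots,\ell\}$; the *reconstruction* of $D$ according to $c$ is $\mathrm{rel}(c^{-1}(1))\oplus\cdots\oplus\mathrm{rel}(c^{-1}(\ell))$, and $c$ is *self-reconstructing* if this equals $D$. For $D_1,D_2$ in a web world $W$ let $f(D_1,D_2,\ell)$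 be the number of $\ell$-colourings of $D_1$ whose reconstruction is $D_2$. The *web-colouring matrix* and the *web-mixing matrix* of $W$ have the entries $$M^{(W)}_{D_1,D_2}(x)=\sum_{\ell\ge1}x^\ell f(D_1,D_2,\ell),\qquad R^{(W)}_{D_1,D_2}=\sum_{\ell\ge1}\frac{(-1)^{\ell-1}}{\ell}f(D_1,D_2,\ell).$$ If $D=E_1\oplus\cdots\oplus E_k$ with all $E_i$ indecomposable, the *decomposition poset* $P=P(D)$ is the set $\{E_1,\dots,E_k\}$ with the partial order generated by (that is, the reflexive transitive closure of) the relations $E_i\preceq E_j$ for $i<j$ such that, in $D$, an endpoint of some edge coming from $E_i$ is below an endpoint of some edge coming from $E_j$ on some peg. Let $\mathcal L(P)$ be the set of words $\pi=E_{i_1}\cdots E_{i_k}$ listing the elements of $P$ in the order of a linear extension of $P$, and let $\mathrm{des}(\pi)$ be the number of $r$ with $1\le r<k$ and $i_r>i_{r+1}$. **Theorem.** Let $W$ be a web world and let $D\in W$ be a non-empty web diagram with $D=E_1\oplus\cdots\oplus E_k$, where $E_1,\dots,E_k$ are pairwise distinct indecomposable web diagrams. Let $P=P(D)$ and $p=|P|=k$.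 Then $$M^{(W)}_{D,D}(x)=\sum_{\pi\in\mathcal L(P)}x^{1+\mathrm{des}(\pi)}(1+x)^{p-1-\mathrm{des}(\pi)}$$ as polynomials in $x$, and $$R^{(W)}_{D,D}=\sum_{\pi\in\mathcal L(P)}\frac{(-1)^{\mathrm{des}(\pi)}}{p\binom{p-1}{\mathrm{des}(\pi)}}.$$ Moreover, for every $\ell$, the self-reconstructing $\ell$-colourings of $D$ are exactly the maps that send every edge coming from the summand $E_i$ to $g(E_i)$, for $i=1,\dots,k$, where $g$ is a surjective order-preserving map from $P$ to $\{1,\dots,\ell\}$. -/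

import Mathlib

open Finset

namespace Web

/-- A 4-tuple `(x, y, a, b)`: an edge whose left vertex has height `a` on peg `x` and whose right
vertex has height `b` on peg `y`. The pegs are indexed by `Fin n`. -/
structure Edge (n : ℕ) where
  left : Fin n
  right : Fin n
  leftHeight : ℕ
  rightHeight : ℕ
  deriving DecidableEq

variable {n : ℕ}

/-- `p_i(D)`: the number of edges of `D` incident with peg `i`. -/
def pegCount (D : Finset (Edge n)) (i : Fin n) : ℕ :=
  #{e ∈ D | e.left = i ∨ e.right = i}

/-- The set of heights of the vertices of `D` on peg `i`. -/
def heightsOn (D : Finset (Edge n)) (i : Fin n) : Finset ℕ :=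
  {e ∈ D | e.right = i}.image Edge.rightHeight ∪ {e ∈ D | e.left = i}.image Edge.leftHeight

/-- `D` is a web diagram on `n` pegs. -/
def IsWebDiagram (D : Finset (Edge n)) : Prop :=
  (∀ e ∈ D, e.left < e.right) ∧ ∀ i, heightsOn D i = Icc 1 (pegCount D i)

/-- Replace every height `h` on peg `i` by `φ i h`. -/
def moveHeights (φ : Fin n → ℕ → ℕ) (D : Finset (Edge n)) : Finset (Edge n) :=
  D.image fun e => ⟨e.left, e.right, φ e.left e.leftHeight, φ e.right e.rightHeight⟩

/-- The sum `D ⊕ D'`: the diagram `D'` placed on top of `D`. -/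
def oplus (D D' : Finset (Edge n)) : Finset (Edge n) :=
  D ∪ moveHeights (fun i h => h + pegCount D i) D'

/-- The iterated sum `E 0 ⊕ E 1 ⊕ ⋯ ⊕ E (k - 1)`. -/
def iteratedSum {k : ℕ} (E : Fin k → Finset (Edge n)) : Finset (Edge n) :=
  (List.ofFn E).foldl oplus ∅

/-- `D` is decomposable: it is the sum of two non-empty web diagrams. -/
def IsDecomposable (D : Finset (Edge n)) : Prop :=
  ∃ E F : Finset (Edge n), IsWebDiagram E ∧ IsWebDiagram F ∧ E.Nonempty ∧ F.Nonempty ∧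
    D = oplus E F

/-- `rel X`: relabel the heights on every peg `i` by `1, …, ℓ_i`, keeping their order. -/
def rel (X : Finset (Edge n)) : Finset (Edge n) :=
  moveHeights (fun i h => #{h' ∈ heightsOn X i | h' ≤ h}) X

/-- The web world of `D`: all `π(D)`, where `π i` permutes the heights `1, …, p_i(D)` on peg `i`. -/
def webWorld (D : Finset (Edge n)) : Set (Finset (Edge n)) :=
  {D' | ∃ π : Fin n → ℕ → ℕ,
    (∀ i, Set.BijOn (π i) (Set.Icc 1 (pegCount D i)) (Set.Icc 1 (pegCount D i))) ∧
    D' = moveHeights π D}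

/-- `D_c(j)`: the set of those edges of `D` that are coloured `j`. -/
def colourClass {D : Finset (Edge n)} {l : ℕ} (c : D → Fin l) (j : Fin l) : Finset (Edge n) :=
  (univ.filter fun e => c e = j).map (Function.Embedding.subtype _)

/-- The reconstruction of `D` according to the colouring `c`. -/
def recon {D : Finset (Edge n)} {l : ℕ} (c : D → Fin l) : Finset (Edge n) :=
  iteratedSum fun j => rel (colourClass c j)

/-- `F(D₁, D₂, l)`: the `l`-colourings of `D₁`, that is, the surjections from the edges of `D₁` onto
`l` linearly ordered colours, for which the reconstruction of `D₁` is `D₂`. -/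
def colourings (D₁ D₂ : Finset (Edge n)) (l : ℕ) : Finset (D₁ → Fin l) :=
  {c | Function.Surjective c ∧ recon c = D₂}

/-- The web-colouring matrix of the web world `W`, with entries `∑_{l ≥ 1} x^l f(D₁, D₂, l)`.
There are no surjections onto more colours than there are edges, so that the sum stops at `#D₁`. -/
noncomputable def webColouringMatrix (W : Set (Finset (Edge n))) :
    Matrix W W (Polynomial ℤ) := fun D₁ D₂ =>
  ∑ l ∈ Icc 1 #D₁.1, Polynomial.X ^ l * ((#(colourings D₁.1 D₂.1 l) : ℕ) : Polynomial ℤ)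

/-- The web-mixing matrix of the web world `W`, with entries
`∑_{l ≥ 1} ((-1)^(l-1) / l) f(D₁, D₂, l)`. -/
def webMixingMatrix (W : Set (Finset (Edge n))) : Matrix W W ℚ := fun D₁ D₂ =>
  ∑ l ∈ Icc 1 #D₁.1, (-1 : ℚ) ^ (l - 1) / (l : ℚ) * (#(colourings D₁.1 D₂.1 l) : ℚ)

/-- The edge `e` has an endpoint of height `h` on peg `i`. -/
def Edge.HasEndpoint (e : Edge n) (i : Fin n) (h : ℕ) : Prop :=
  (e.left = i ∧ e.leftHeight = h) ∨ (e.right = i ∧ e.rightHeight = h)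

/-- The edges of `E 0 ⊕ ⋯ ⊕ E (k - 1)` that come from the summand `E i`, with the heights that they
have in the sum. -/
def summandEdges {k : ℕ} (E : Fin k → Finset (Edge n)) (i : Fin k) : Finset (Edge n) :=
  moveHeights (fun x h => h + ∑ m with m < i, pegCount (E m) x) (E i)

/-- The generating relation of the decomposition poset: `i < j`, and some endpoint of an edge of the
summand `E i` is below some endpoint of an edge of the summand `E j` on some peg. -/
def IsBelow {k : ℕ} (E : Fin k → Finset (Edge n)) (i j : Fin k) : Prop :=
  i < j ∧ ∃ e ∈ summandEdges E i, ∃ e' ∈ summandEdges E j, ∃ (x : Fin n) (h h' : ℕ),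
    e.HasEndpoint x h ∧ e'.HasEndpoint x h' ∧ h < h'

theorem le_of_reflTransGen_isBelow {k : ℕ} (E : Fin k → Finset (Edge n)) {i j : Fin k}
    (h : Relation.ReflTransGen (IsBelow E) i j) : i ≤ j := by
  induction h with
  | refl => exact le_rfl
  | tail _ hbc ih => exact ih.trans hbc.1.le

/-- The decomposition poset of the diagram `E 0 ⊕ ⋯ ⊕ E (k - 1)`, on the (naturally labelled) index
set of the summands: the partial order generated by `IsBelow E`. -/
abbrev decompositionPoset {k : ℕ} (E : Fin k → Finset (Edge n)) : PartialOrder (Fin k) where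
  le := Relation.ReflTransGen (IsBelow E)
  lt i j := Relation.ReflTransGen (IsBelow E) i j ∧ ¬ Relation.ReflTransGen (IsBelow E) j i
  lt_iff_le_not_ge _ _ := Iff.rfl
  le_refl _ := Relation.ReflTransGen.refl
  le_trans _ _ _ := Relation.ReflTransGen.trans
  le_antisymm _ _ h h' :=
    le_antisymm (le_of_reflTransGen_isBelow E h) (le_of_reflTransGen_isBelow E h')

/-- The map `f` from the poset `P` to `Fin l` is order-preserving. -/
def OrderPreserving {k l : ℕ} (P : PartialOrder (Fin k)) (f : Fin k → Fin l) : Prop :=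
  ∀ a b, P.le a b → f a ≤ f b

open Classical in
/-- The Jordan–Hölder set of a partial order `P` on `Fin k`: the permutations `π = π 0 π 1 ⋯ π (k-1)`
of the elements for which the map sending each element to its position is order-preserving. -/
noncomputable def jordanHolderSet {k : ℕ} (P : PartialOrder (Fin k)) :
    Finset (Equiv.Perm (Fin k)) :=
  {π | OrderPreserving P π.symm}

/-- The number of descents of the word `π 0 π 1 ⋯ π (k-1)`. -/
def des {k : ℕ} (π : Equiv.Perm (Fin k)) : ℕ :=
  #{i : Fin k | ∃ h : i.val + 1 < k, π ⟨i.val + 1, h⟩ < π i}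

end Web

namespace Web

variable {n : ℕ}

/-! In a reconstruction, the endpoints on each peg are sorted first by colour, then by old height
(`exists_recon_map`). Since heights on a peg are exactly 1, …, p, a peg-preserving bijection of
diagrams that keeps the order on every peg is the identity (`IsWebDiagram.rigid`). Hence colouring
the summands by an order-preserving map changes nothing.

Conversely, let c be self-reconstructing and ψ the resulting permutation of the edges of D. Give
each edge the pair (colour, summand) of its ψ-preimage, ordered lexicographically. This pair weakly
increases along pegs, and such a function is constant on every indecomposable summand, since a level
cut would split it (`eq_of_mem_summandEdges`). So summand i comes from a single summand s(i), in one
colour. The map s is onto, hence a permutation; rigidity gives E(s i) = E i, and distinctness gives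
s = id. Thus c is constant on summands, and order-preserving because ψ would otherwise invert
heights on a shared peg.

It remains to count order-preserving surjections of a naturally labelled poset onto chains. Listing
the elements by value, ties by label, gives a linear extension π; the surjections with a given π
correspond to jump sets containing the descents of π (`card_orderPreserving`). With d = des π,
summing a weight w(l) over them gives ∑ C(p-1-d, m) w(1+d+m): the binomial theorem for w(l) = x^l, a
Beta integral for w(l) = (-1)^(l-1)/l. -/

/-! ### Edges, pegs and the order of heights -/

/-- The edge `e` has an endpoint on peg `x`. -/
abbrev Edge.Meets (e : Edge n) (x : Fin n) : Prop := e.left = x ∨ e.right = x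

/-- The height of the endpoint of `e` on peg `x`. -/
def Edge.ht (e : Edge n) (x : Fin n) : ℕ := if e.left = x then e.leftHeight else e.rightHeight

/-- Replace every height `h` on peg `x` by `φ x h`. -/
def Edge.move (φ : Fin n → ℕ → ℕ) (e : Edge n) : Edge n :=
  ⟨e.left, e.right, φ e.left e.leftHeight, φ e.right e.rightHeight⟩

theorem Edge.ht_move {φ : Fin n → ℕ → ℕ} {e : Edge n} {x : Fin n} (h : e.Meets x) :
    (e.move φ).ht x = φ x (e.ht x) := by
  unfold Edge.ht Edge.move
  by_cases hx : e.left = x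
  · simp [hx]
  · have : e.right = x := by tauto
    simp [hx, this]

theorem Edge.move_move (φ ψ : Fin n → ℕ → ℕ) (e : Edge n) :
    (e.move φ).move ψ = e.move fun x h => ψ x (φ x h) := rfl

theorem Edge.ext_ht {e e' : Edge n} (hl : e.left = e'.left) (hr : e.right = e'.right)
    (hlr : e.left < e.right) (h : ∀ x, e.Meets x → e.ht x = e'.ht x) : e = e' := by
  have h1 := h e.left (Or.inl rfl)
  have h2 := h e.right (Or.inr rfl)
  cases e; cases e'
  simp only [Edge.ht] at *
  subst hl hr
  simp_all [hlr.ne]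

theorem Edge.move_eq_self {φ : Fin n → ℕ → ℕ} {e : Edge n} (hlr : e.left < e.right)
    (h : ∀ x, e.Meets x → φ x (e.ht x) = e.ht x) : e.move φ = e :=
  Edge.ext_ht rfl rfl hlr fun x hx =>
    (Edge.ht_move (e := e) hx).trans (h x hx)

theorem Edge.hasEndpoint_iff {e : Edge n} (hlr : e.left < e.right) {x : Fin n} {h : ℕ} :
    e.HasEndpoint x h ↔ e.Meets x ∧ e.ht x = h := by
  unfold Edge.HasEndpoint Edge.Meets Edge.ht
  by_cases hx : e.left = x
  · have : e.right ≠ x := by rw [← hx]; exact hlr.ne'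
    simp [hx, this]
  · simp [hx]

/-- All edges of `D` go from left to right, and no two of them share an endpoint. -/
structure IsPreWeb (D : Finset (Edge n)) : Prop where
  lt : ∀ e ∈ D, e.left < e.right
  inj : ∀ e ∈ D, ∀ e' ∈ D, ∀ x, e.Meets x → e'.Meets x → e.ht x = e'.ht x → e = e'

theorem IsPreWeb.mono {D D' : Finset (Edge n)} (h : IsPreWeb D) (hs : D' ⊆ D) : IsPreWeb D' :=
  ⟨fun e he => h.lt e (hs he), fun e he e' he' => h.inj e (hs he) e' (hs he')⟩

theorem heightsOn_eq_image {D : Finset (Edge n)} (h : ∀ e ∈ D, e.left < e.right) (x : Fin n) :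
    heightsOn D x = {e ∈ D | e.Meets x}.image fun e => e.ht x := by
  ext a
  simp only [heightsOn, mem_union, mem_image, mem_filter]
  constructor
  · rintro (⟨e, ⟨he, hx⟩, rfl⟩ | ⟨e, ⟨he, hx⟩, rfl⟩)
    · refine ⟨e, ⟨he, Or.inr hx⟩, ?_⟩
      exact ((Edge.hasEndpoint_iff (h e he)).1 (Or.inr ⟨hx, rfl⟩)).2
    · refine ⟨e, ⟨he, Or.inl hx⟩, ?_⟩
      exact ((Edge.hasEndpoint_iff (h e he)).1 (Or.inl ⟨hx, rfl⟩)).2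
  · rintro ⟨e, ⟨he, hx⟩, rfl⟩
    rcases (Edge.hasEndpoint_iff (h e he)).2 ⟨hx, rfl⟩ with ⟨h1, h2⟩ | ⟨h1, h2⟩
    · exact Or.inr ⟨e, ⟨he, h1⟩, h2⟩
    · exact Or.inl ⟨e, ⟨he, h1⟩, h2⟩

theorem IsPreWeb.card_heightsOn {D : Finset (Edge n)} (h : IsPreWeb D) (x : Fin n) :
    #(heightsOn D x) = pegCount D x := by
  rw [heightsOn_eq_image h.lt, card_image_of_injOn]
  · rfl
  · intro e he e' he' hh
    simp only [coe_filter, Set.mem_ofPred_eq] at he he'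
    exact h.inj e he.1 e' he'.1 x he.2 he'.2 hh

/-- Pigeonhole: on a peg with p endpoints, filling 1, …, p is the same as having distinct heights in
that range. -/
theorem isWebDiagram_iff {D : Finset (Edge n)} : IsWebDiagram D ↔
    IsPreWeb D ∧ ∀ e ∈ D, ∀ x, e.Meets x → 1 ≤ e.ht x ∧ e.ht x ≤ pegCount D x := by
  constructor
  · rintro ⟨h1, h2⟩
    have key : ∀ x, ({e ∈ D | e.Meets x}.image fun e => e.ht x) = Icc 1 (pegCount D x) :=
      fun x => by rw [← heightsOn_eq_image h1, h2]
    refine ⟨⟨h1, fun e he e' he' x hx hx' hh => ?_⟩, fun e he x hx => ?_⟩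
    · have hc : #({e ∈ D | e.Meets x}.image fun e => e.ht x) = #{e ∈ D | e.Meets x} := by
        rw [key]; simp [pegCount]
      exact card_image_iff.1 hc (by simp [he, hx]) (by simp [he', hx']) hh
    · rw [← mem_Icc, ← key]
      exact mem_image_of_mem _ (by simp [he, hx])
  · rintro ⟨h1, h2⟩
    refine ⟨h1.lt, fun x => eq_of_subset_of_card_le ?_ ?_⟩
    · rw [heightsOn_eq_image h1.lt]
      intro a ha
      simp only [mem_image, mem_filter] at ha
      obtain ⟨e, ⟨he, hx⟩, rfl⟩ := ha
      exact mem_Icc.2 (h2 e he x hx)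
    · rw [h1.card_heightsOn]; simp

theorem IsWebDiagram.isPreWeb {D : Finset (Edge n)} (h : IsWebDiagram D) : IsPreWeb D :=
  (isWebDiagram_iff.1 h).1

/-- There are no gaps below an occupied height. This recovers heights from their order alone, which
is what makes `IsWebDiagram.rigid` work. -/
theorem IsWebDiagram.ht_eq_card {D : Finset (Edge n)} (h : IsWebDiagram D) {e : Edge n}
    (he : e ∈ D) {x : Fin n} (hx : e.Meets x) :
    e.ht x = #{e' ∈ D | e'.Meets x ∧ e'.ht x ≤ e.ht x} := by
  have h3 : ({e' ∈ D | e'.Meets x ∧ e'.ht x ≤ e.ht x}.image fun e => e.ht x) =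
      Icc 1 (e.ht x) := by
    ext a
    simp only [mem_image, mem_filter, mem_Icc]
    constructor
    · rintro ⟨e', ⟨he', hx', hle⟩, rfl⟩
      exact ⟨((isWebDiagram_iff.1 h).2 e' he' x hx').1, hle⟩
    · rintro ⟨h1, h2⟩
      have : a ∈ heightsOn D x := by
        rw [h.2, mem_Icc]
        exact ⟨h1, h2.trans ((isWebDiagram_iff.1 h).2 e he x hx).2⟩
      rw [heightsOn_eq_image h.1] at this
      simp only [mem_image, mem_filter] at this
      obtain ⟨e', ⟨he', hx'⟩, rfl⟩ := this
      exact ⟨e', ⟨he', hx', h2⟩, rfl⟩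
  rw [← card_image_of_injOn (f := fun e : Edge n => e.ht x), h3]
  · simp
  · intro a ha b hb hh
    simp only [coe_filter, Set.mem_ofPred_eq] at ha hb
    exact h.isPreWeb.inj a ha.1 b hb.1 x ha.2.1 hb.2.1 hh

/-- A peg-preserving bijection between web diagrams that preserves the order of the heights on every
peg is the identity. -/
theorem IsWebDiagram.rigid {ι : Type*} (T : Finset ι) (u v : ι → Edge n)
    (hu : IsWebDiagram (T.image u)) (hv : IsWebDiagram (T.image v))
    (hui : Set.InjOn u T) (hvi : Set.InjOn v T)
    (hl : ∀ t ∈ T, (u t).left = (v t).left) (hr : ∀ t ∈ T, (u t).right = (v t).right)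
    (hlt : ∀ s ∈ T, ∀ t ∈ T, ∀ x, (u s).Meets x → (u t).Meets x → (u s).ht x < (u t).ht x →
      (v s).ht x < (v t).ht x) :
    ∀ t ∈ T, u t = v t := by
  have hm : ∀ t ∈ T, ∀ x, (u t).Meets x ↔ (v t).Meets x := fun t ht x => by
    rw [Edge.Meets, Edge.Meets, hl t ht, hr t ht]
  intro t ht
  have htu := mem_image_of_mem u ht
  have htv := mem_image_of_mem v ht
  refine Edge.ext_ht (hl t ht) (hr t ht) (hu.1 _ htu) fun x hx => ?_
  have hx' := (hm t ht x).1 hx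
  rw [hu.ht_eq_card htu hx, hv.ht_eq_card htv hx', filter_image, filter_image,
    card_image_of_injOn (hui.mono (by simp +contextual [Set.subset_def])),
    card_image_of_injOn (hvi.mono (by simp +contextual [Set.subset_def]))]
  congr 1
  ext s
  simp only [mem_filter]
  refine and_congr_right fun hs => ?_
  rw [← hm s hs x]
  refine and_congr_right fun hsx => ?_
  have hsx' := (hm s hs x).1 hsx
  constructor
  · intro hle
    rcases hle.lt_or_eq with h | h
    · exact (hlt s hs t ht x hsx hx h).le
    · have := hui hs ht (hu.isPreWeb.inj _ (mem_image_of_mem u hs) _ htu x hsx hx h)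
      rw [this]
  · intro hle
    by_contra h
    exact absurd (hlt t ht s hs x hx hsx (not_le.1 h)) (not_lt.2 hle)

theorem pegCount_image {ι : Type*} (T : Finset ι) (u : ι → Edge n)
    (hui : Set.InjOn u T) (x : Fin n) : pegCount (T.image u) x = #{t ∈ T | (u t).Meets x} := by
  unfold pegCount
  rw [filter_image, card_image_of_injOn (hui.mono (by simp +contextual [Set.subset_def]))]

/-! ### Sums of web diagrams and their summands -/

/-- Raise all heights on every peg `x` by `a x`. -/
def Edge.shift (a : Fin n → ℕ) : Edge n → Edge n := Edge.move fun x h => h + a x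

/-- Lower all heights on every peg `x` by `a x`. -/
def Edge.unshift (a : Fin n → ℕ) : Edge n → Edge n := Edge.move fun x h => h - a x

theorem Edge.unshift_shift (a : Fin n → ℕ) (e : Edge n) : (e.shift a).unshift a = e := by
  simp [Edge.shift, Edge.unshift, Edge.move]

theorem Edge.shift_injective (a : Fin n → ℕ) : Function.Injective (Edge.shift a) :=
  Function.LeftInverse.injective (Edge.unshift_shift a)

theorem pegCount_image_shift (a : Fin n → ℕ) (D : Finset (Edge n)) (x : Fin n) :
    pegCount (D.image (Edge.shift a)) x = pegCount D x :=
  pegCount_image D _ (Edge.shift_injective a).injOn x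

theorem Edge.ht_shift {a : Fin n → ℕ} {e : Edge n} {x : Fin n} (h : e.Meets x) :
    (e.shift a).ht x = e.ht x + a x := Edge.ht_move h

theorem Edge.ht_unshift {a : Fin n → ℕ} {e : Edge n} {x : Fin n} (h : e.Meets x) :
    (e.unshift a).ht x = e.ht x - a x := Edge.ht_move h

theorem oplus_eq (D D' : Finset (Edge n)) :
    oplus D D' = D ∪ D'.image (Edge.shift (pegCount D)) := rfl

theorem summandEdges_eq {k : ℕ} (E : Fin k → Finset (Edge n)) (i : Fin k) :
    summandEdges E i = (E i).image (Edge.shift fun x => ∑ m with m < i, pegCount (E m) x) := rfl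

theorem pegCount_union {A B : Finset (Edge n)} (h : Disjoint A B) (x : Fin n) :
    pegCount (A ∪ B) x = pegCount A x + pegCount B x := by
  unfold pegCount
  rw [filter_union, card_union_of_disjoint (disjoint_filter_filter h)]

theorem IsWebDiagram.disjoint_shift {A B : Finset (Edge n)} (hA : IsWebDiagram A)
    (hB : IsWebDiagram B) : Disjoint A (B.image (Edge.shift (pegCount A))) := by
  rw [disjoint_left]
  rintro _ he he'
  obtain ⟨e, he1, rfl⟩ := mem_image.1 he'
  have h1 := ((isWebDiagram_iff.1 hA).2 _ he e.left (Or.inl rfl)).2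
  have h2 := ((isWebDiagram_iff.1 hB).2 _ he1 e.left (Or.inl rfl)).1
  rw [Edge.ht_shift (Or.inl rfl)] at h1
  omega

theorem IsWebDiagram.pegCount_oplus {A B : Finset (Edge n)} (hA : IsWebDiagram A)
    (hB : IsWebDiagram B) (x : Fin n) :
    pegCount (oplus A B) x = pegCount A x + pegCount B x := by
  rw [oplus_eq, pegCount_union (hA.disjoint_shift hB), pegCount_image_shift]

theorem IsWebDiagram.oplus {A B : Finset (Edge n)} (hA : IsWebDiagram A)
    (hB : IsWebDiagram B) : IsWebDiagram (oplus A B) := by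
  have hp := hA.pegCount_oplus hB
  obtain ⟨hA1, hA2⟩ := isWebDiagram_iff.1 hA
  obtain ⟨hB1, hB2⟩ := isWebDiagram_iff.1 hB
  refine isWebDiagram_iff.2 ⟨⟨fun e he => ?_, fun e he e' he' x hx hx' hh => ?_⟩,
    fun e he x hx => ?_⟩
  · rcases mem_union.1 he with he | he
    · exact hA1.lt e he
    · obtain ⟨e, h_e, rfl⟩ := mem_image.1 he
      exact hB1.lt e h_e
  · rcases mem_union.1 he with he | he <;> rcases mem_union.1 he' with he' | he'
    · exact hA1.inj e he e' he' x hx hx' hh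
    · obtain ⟨e', h_e', rfl⟩ := mem_image.1 he'
      have h1 := (hA2 e he x hx).2
      have h2 := (hB2 e' h_e' x hx').1
      have h3 : (e'.shift (pegCount A)).ht x = _ := Edge.ht_shift hx'
      change _ = (e'.shift (pegCount A)).ht x at hh
      omega
    · obtain ⟨e, h_e, rfl⟩ := mem_image.1 he
      have h1 := (hA2 e' he' x hx').2
      have h2 := (hB2 e h_e x hx).1
      have h3 : (e.shift (pegCount A)).ht x = _ := Edge.ht_shift hx
      change (e.shift (pegCount A)).ht x = _ at hh
      omega
    · obtain ⟨e', h_e', rfl⟩ := mem_image.1 he'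
      obtain ⟨e, h_e, rfl⟩ := mem_image.1 he
      have h3 : (e.shift (pegCount A)).ht x = _ := Edge.ht_shift hx
      have h4 : (e'.shift (pegCount A)).ht x = _ := Edge.ht_shift hx'
      change (e.shift (pegCount A)).ht x = (e'.shift (pegCount A)).ht x at hh
      rw [hB1.inj e h_e e' h_e' x hx hx' (by omega)]
  · rw [hp]
    rcases mem_union.1 he with he | he
    · have := hA2 e he x hx
      omega
    · obtain ⟨e, h_e, rfl⟩ := mem_image.1 he
      have h3 : (e.shift (pegCount A)).ht x = _ := Edge.ht_shift hx
      change 1 ≤ (e.shift (pegCount A)).ht x ∧ (e.shift (pegCount A)).ht x ≤ _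
      have := hB2 e h_e x hx
      omega

theorem iteratedSum_succ {k : ℕ} (E : Fin (k + 1) → Finset (Edge n)) :
    iteratedSum E = oplus (iteratedSum fun i : Fin k => E i.castSucc) (E (Fin.last k)) := by
  rw [iteratedSum, iteratedSum, List.ofFn_succ', List.concat_eq_append, List.foldl_append]
  rfl

theorem isWebDiagram_empty : IsWebDiagram (∅ : Finset (Edge n)) := by
  simp [IsWebDiagram, heightsOn, pegCount]

theorem sum_filter_lt_castSucc {k : ℕ} {M : Type*} [AddCommMonoid M] (f : Fin (k + 1) → M)
    (i : Fin k) : ∑ m with m < i.castSucc, f m = ∑ m with m < i, f m.castSucc := by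
  simp only [sum_filter]
  rw [Fin.sum_univ_castSucc, if_neg (by simp [Fin.le_last]), add_zero]
  simp

theorem sum_filter_lt_last {k : ℕ} {M : Type*} [AddCommMonoid M] (f : Fin (k + 1) → M) :
    ∑ m with m < Fin.last k, f m = ∑ m : Fin k, f m.castSucc := by
  simp only [sum_filter]
  rw [Fin.sum_univ_castSucc, if_neg (by simp), add_zero]
  simp [Fin.castSucc_lt_last]

theorem iteratedSum_spec {k : ℕ} (E : Fin k → Finset (Edge n)) (hE : ∀ i, IsWebDiagram (E i)) :
    IsWebDiagram (iteratedSum E) ∧ (∀ x, pegCount (iteratedSum E) x = ∑ i, pegCount (E i) x) ∧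
      ∀ e, e ∈ iteratedSum E ↔ ∃ i, e ∈ summandEdges E i := by
  induction k with
  | zero =>
    refine ⟨isWebDiagram_empty, ?_, ?_⟩
    · simp [iteratedSum, pegCount]
    · simp [iteratedSum]
  | succ k ih =>
    obtain ⟨h1, h2, h3⟩ := ih (fun i => E i.castSucc) fun i => hE _
    rw [iteratedSum_succ]
    refine ⟨h1.oplus (hE _), fun x => ?_, fun e => ?_⟩
    · rw [h1.pegCount_oplus (hE _), h2, Fin.sum_univ_castSucc]
    · rw [oplus_eq, mem_union, h3, Fin.exists_fin_succ']
      refine or_congr (exists_congr fun i => ?_) ?_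
      · simp only [summandEdges_eq, sum_filter_lt_castSucc]
      · simp only [summandEdges_eq, sum_filter_lt_last, ← h2]

theorem mem_summandEdges {k : ℕ} {E : Fin k → Finset (Edge n)} {i : Fin k} {e : Edge n} :
    e ∈ summandEdges E i ↔
      ∃ e' ∈ E i, e'.shift (fun x => ∑ m with m < i, pegCount (E m) x) = e := by
  rw [summandEdges_eq, mem_image]

/-- The summands occupy consecutive, disjoint intervals of heights on each peg. -/
theorem summandEdges_bounds {k : ℕ} {E : Fin k → Finset (Edge n)} {i : Fin k}
    (hE : IsWebDiagram (E i)) {e : Edge n} (he : e ∈ summandEdges E i) {x : Fin n}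
    (hx : e.Meets x) : ∑ m with m < i, pegCount (E m) x < e.ht x ∧
      e.ht x ≤ ∑ m with m < i, pegCount (E m) x + pegCount (E i) x := by
  obtain ⟨e, h_e, rfl⟩ := mem_summandEdges.1 he
  have h1 := (isWebDiagram_iff.1 hE).2 e h_e x hx
  have h2 := Edge.ht_shift (a := fun x => ∑ m with m < i, pegCount (E m) x) (e := e) hx
  omega

theorem ht_lt_of_summand_lt {k : ℕ} {E : Fin k → Finset (Edge n)} (hE : ∀ i, IsWebDiagram (E i))
    {i j : Fin k} (hij : i < j) {e e' : Edge n} (he : e ∈ summandEdges E i)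
    (he' : e' ∈ summandEdges E j) {x : Fin n} (hx : e.Meets x) (hx' : e'.Meets x) :
    e.ht x < e'.ht x := by
  have h1 := (summandEdges_bounds (hE i) he hx).2
  have h2 := (summandEdges_bounds (hE j) he' hx').1
  have h3 : ∑ m with m < i, pegCount (E m) x + pegCount (E i) x ≤
      ∑ m with m < j, pegCount (E m) x := by
    have : pegCount (E i) x + ∑ m with m < i, pegCount (E m) x =
        ∑ m ∈ insert i ({m | m < i} : Finset (Fin k)), pegCount (E m) x := by
      rw [sum_insert]; simp
    rw [add_comm, this]
    refine sum_le_sum_of_subset fun m hm => ?_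
    simp only [mem_insert, mem_filter, mem_univ, true_and] at hm ⊢
    rcases hm with rfl | hm
    · exact hij
    · exact hm.trans hij
  omega

theorem summand_unique {k : ℕ} {E : Fin k → Finset (Edge n)} (hE : ∀ i, IsWebDiagram (E i))
    {i j : Fin k} {e : Edge n} (he : e ∈ summandEdges E i) (he' : e ∈ summandEdges E j) :
    i = j := by
  by_contra h
  rcases lt_or_gt_of_ne h with h | h
  · exact lt_irrefl _ (ht_lt_of_summand_lt hE h he he' (x := e.left) (Or.inl rfl) (Or.inl rfl))
  · exact lt_irrefl _ (ht_lt_of_summand_lt hE h he' he (x := e.left) (Or.inl rfl) (Or.inl rfl))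

/-- The height inequality in `IsBelow` is automatic for i < j, so only a shared peg matters. -/
theorem isBelow_iff {k : ℕ} {E : Fin k → Finset (Edge n)} (hE : ∀ i, IsWebDiagram (E i))
    {i j : Fin k} : IsBelow E i j ↔ i < j ∧ ∃ e ∈ summandEdges E i, ∃ e' ∈ summandEdges E j,
      ∃ x, e.Meets x ∧ e'.Meets x := by
  have hlt : ∀ i, ∀ e ∈ summandEdges E i, e.left < e.right := fun i e he => by
    obtain ⟨e, h_e, rfl⟩ := mem_summandEdges.1 he
    exact (hE i).1 e h_e
  refine and_congr_right fun hij => exists_congr fun e => and_congr_right fun he =>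
    exists_congr fun e' => and_congr_right fun he' => exists_congr fun x => ?_
  simp only [Edge.hasEndpoint_iff (hlt _ _ he), Edge.hasEndpoint_iff (hlt _ _ he')]
  constructor
  · rintro ⟨h, h', h1, h2, -⟩
    exact ⟨h1.1, h2.1⟩
  · rintro ⟨h1, h2⟩
    exact ⟨_, _, ⟨h1, rfl⟩, ⟨h2, rfl⟩, ht_lt_of_summand_lt hE hij he he' h1 h2⟩

/-! ### Monotone functions on indecomposable diagrams -/

/-- A function on the edges of an indecomposable diagram that weakly increases along every peg is
constant. -/
theorem eq_of_not_isDecomposable {α : Type*} [LinearOrder α] {D : Finset (Edge n)}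
    (hD : IsWebDiagram D) (hind : ¬ IsDecomposable D) (f : Edge n → α)
    (hf : ∀ e ∈ D, ∀ e' ∈ D, ∀ x, e.Meets x → e'.Meets x → e.ht x < e'.ht x → f e ≤ f e')
    {e e' : Edge n} (he : e ∈ D) (he' : e' ∈ D) : f e = f e' := by
  by_contra hne
  wlog hlt : f e < f e' generalizing e e'
  · exact this he' he (Ne.symm hne) (lt_of_le_of_ne (not_lt.1 hlt) (Ne.symm hne))
  apply hind
  obtain ⟨hD1, hD2⟩ := isWebDiagram_iff.1 hD
  -- Cut at the level `f e`. As `f` increases along pegs, `A` fills an initial segment of every peg,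
  -- so lowering `B` by `pegCount A` exhibits `D` as a sum.
  set A := {d ∈ D | f d ≤ f e} with hA
  set B := {d ∈ D | ¬ f d ≤ f e} with hB
  have hAD : A ⊆ D := filter_subset _ _
  have hBD : B ⊆ D := filter_subset _ _
  have hAB : A ∪ B = D := filter_union_filter_not_eq _ _
  have hdisj : Disjoint A B := disjoint_filter_filter_not _ _ _
  have hpc : ∀ x, pegCount D x = pegCount A x + pegCount B x := fun x => by
    rw [← hAB, pegCount_union hdisj]
  have hAup : ∀ d ∈ A, ∀ x, d.Meets x → d.ht x ≤ pegCount A x := fun d hd x hx => by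
    rw [hD.ht_eq_card (hAD hd) hx]
    refine card_le_card fun d' hd' => ?_
    obtain ⟨h1, h2, h3⟩ := mem_filter.1 hd'
    refine mem_filter.2 ⟨?_, h2⟩
    rcases h3.lt_or_eq with h | h
    · exact mem_filter.2 ⟨h1, (hf d' h1 d (hAD hd) x h2 hx h).trans (mem_filter.1 hd).2⟩
    · rwa [hD1.inj d' h1 d (hAD hd) x h2 hx h]
  have hBlow : ∀ d ∈ B, ∀ x, d.Meets x → pegCount A x < d.ht x := fun d hd x hx => by
    rw [hD.ht_eq_card (hBD hd) hx]
    refine card_lt_card ⟨fun d' hd' => ?_, fun hsub => ?_⟩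
    · obtain ⟨h1, h2⟩ := mem_filter.1 hd'
      refine mem_filter.2 ⟨hAD h1, h2, not_lt.1 fun h => ?_⟩
      exact (mem_filter.1 hd).2 ((hf d (hBD hd) d' (hAD h1) x hx h2 h).trans (mem_filter.1 h1).2)
    · have := hsub (mem_filter.2 ⟨hBD hd, hx, le_rfl⟩)
      exact disjoint_left.1 hdisj (mem_filter.1 this).1 hd
  -- The truncated subtraction loses nothing: heights in `B` exceed `pegCount A`.
  have hsu : ∀ d ∈ B, (d.unshift (pegCount A)).shift (pegCount A) = d := fun d hd => by
    unfold Edge.shift Edge.unshift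
    rw [Edge.move_move]
    exact Edge.move_eq_self (hD1.lt d (hBD hd)) fun x hx => Nat.sub_add_cancel (hBlow d hd x hx).le
  have hinj : Set.InjOn (Edge.unshift (pegCount A)) B := fun d hd d' hd' h => by
    rw [← hsu d hd, ← hsu d' hd', h]
  have hpB : ∀ x, pegCount (B.image (Edge.unshift (pegCount A))) x = pegCount B x := fun x =>
    pegCount_image B _ hinj x
  refine ⟨A, B.image (Edge.unshift (pegCount A)), ?_, ?_, ⟨e, by simp [hA, he]⟩,
    Nonempty.image ⟨e', by simp [hB, he', hlt]⟩ _, ?_⟩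
  · exact isWebDiagram_iff.2 ⟨hD1.mono hAD, fun d hd x hx =>
      ⟨(hD2 d (hAD hd) x hx).1, hAup d hd x hx⟩⟩
  · refine isWebDiagram_iff.2 ⟨⟨fun d hd => ?_, fun d hd d' hd' x hx hx' hh => ?_⟩,
      fun d hd x hx => ?_⟩
    · obtain ⟨d, h_d, rfl⟩ := mem_image.1 hd
      exact hD1.lt d (hBD h_d)
    · obtain ⟨d, h_d, rfl⟩ := mem_image.1 hd
      obtain ⟨d', h_d', rfl⟩ := mem_image.1 hd'
      rw [Edge.ht_unshift (e := d) hx, Edge.ht_unshift (e := d') hx'] at hh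
      have h1 := hBlow d h_d x hx
      have h2 := hBlow d' h_d' x hx'
      rw [hD1.inj d (hBD h_d) d' (hBD h_d') x hx hx' (by omega)]
    · obtain ⟨d, h_d, rfl⟩ := mem_image.1 hd
      rw [Edge.ht_unshift (e := d) hx, hpB]
      have h1 := hBlow d h_d x hx
      have h2 := (hD2 d (hBD h_d) x hx).2
      rw [hpc] at h2
      omega
  · rw [oplus_eq, image_image]
    have : B.image (Edge.shift (pegCount A) ∘ Edge.unshift (pegCount A)) = B := by
      exact (image_congr (g := id) fun d hd => hsu d hd).trans image_id
    rw [this, hAB]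

/-! ### Relabelling and reconstruction -/

theorem rank_le {X : Finset (Edge n)} (hX : IsPreWeb X) (x : Fin n) (h : ℕ) :
    #{h' ∈ heightsOn X x | h' ≤ h} ≤ pegCount X x := by
  rw [← hX.card_heightsOn]
  exact card_le_card (filter_subset _ _)

theorem ht_mem_heightsOn {X : Finset (Edge n)} (hX : IsPreWeb X) {e : Edge n} (he : e ∈ X)
    {x : Fin n} (hx : e.Meets x) : e.ht x ∈ heightsOn X x := by
  rw [heightsOn_eq_image hX.lt]
  exact mem_image_of_mem _ (mem_filter.2 ⟨he, hx⟩)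

theorem rank_lt {X : Finset (Edge n)} (hX : IsPreWeb X) {e : Edge n} (he : e ∈ X)
    {x : Fin n} (hx : e.Meets x) {a : ℕ} (ha : a < e.ht x) :
    #{h' ∈ heightsOn X x | h' ≤ a} < #{h' ∈ heightsOn X x | h' ≤ e.ht x} := by
  refine card_lt_card ⟨fun b hb => ?_, fun hsub => ?_⟩
  · rw [mem_filter] at hb ⊢
    exact ⟨hb.1, hb.2.trans ha.le⟩
  · have := hsub (mem_filter.2 ⟨ht_mem_heightsOn hX he hx, le_rfl⟩)
    exact absurd (mem_filter.1 this).2 (not_le.2 ha)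

theorem rel_eq (X : Finset (Edge n)) :
    rel X = X.image (Edge.move fun x h => #{h' ∈ heightsOn X x | h' ≤ h}) := rfl

theorem rank_injOn {X : Finset (Edge n)} (hX : IsPreWeb X) {e e' : Edge n} (he : e ∈ X)
    (he' : e' ∈ X) {x : Fin n} (hx : e.Meets x) (hx' : e'.Meets x)
    (h : (e.move fun x h => #{h' ∈ heightsOn X x | h' ≤ h}).ht x =
      (e'.move fun x h => #{h' ∈ heightsOn X x | h' ≤ h}).ht x) : e = e' := by
  rw [Edge.ht_move hx, Edge.ht_move hx'] at h
  refine hX.inj e he e' he' x hx hx' ?_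
  rcases lt_trichotomy (e.ht x) (e'.ht x) with hlt | heq | hlt
  · exact absurd h (rank_lt hX he' hx' hlt).ne
  · exact heq
  · exact absurd h (rank_lt hX he hx hlt).ne'

theorem pegCount_rel {X : Finset (Edge n)} (hX : IsPreWeb X) (x : Fin n) :
    pegCount (rel X) x = pegCount X x := by
  rw [rel_eq]
  refine pegCount_image X _ (fun e he e' he' h => ?_) x
  have hl : (e.move _).left = (e'.move _).left := congrArg Edge.left h
  exact rank_injOn hX he he' (x := e.left) (Or.inl rfl) (Or.inl hl.symm) (by rw [h])

theorem IsPreWeb.isWebDiagram_rel {X : Finset (Edge n)} (hX : IsPreWeb X) :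
    IsWebDiagram (rel X) := by
  refine isWebDiagram_iff.2 ⟨⟨fun e he => ?_, fun e he e' he' x hx hx' hh => ?_⟩,
    fun e he x hx => ?_⟩
  · obtain ⟨e, h_e, rfl⟩ := mem_image.1 (rel_eq X ▸ he)
    exact hX.lt e h_e
  · obtain ⟨e, h_e, rfl⟩ := mem_image.1 (rel_eq X ▸ he)
    obtain ⟨e', h_e', rfl⟩ := mem_image.1 (rel_eq X ▸ he')
    rw [rank_injOn hX h_e h_e' hx hx' hh]
  · obtain ⟨e, h_e, rfl⟩ := mem_image.1 (rel_eq X ▸ he)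
    rw [pegCount_rel hX, Edge.ht_move (e := e) hx]
    refine ⟨card_pos.2 ⟨e.ht x, ?_⟩, rank_le hX x _⟩
    exact mem_filter.2 ⟨ht_mem_heightsOn hX h_e hx, le_rfl⟩

theorem mem_colourClass {D : Finset (Edge n)} {l : ℕ} {c : D → Fin l} {j : Fin l} {e : Edge n} :
    e ∈ colourClass c j ↔ ∃ h : e ∈ D, c ⟨e, h⟩ = j := by
  simp [colourClass]

/-- The reconstruction is the image of `D` under a peg-preserving map that on every peg sorts the
endpoints first by colour and then by height. -/
theorem exists_recon_map {D : Finset (Edge n)} (hD : IsPreWeb D) {l : ℕ} (c : D → Fin l) :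
    IsWebDiagram (recon c) ∧ ∃ φ : D → Edge n, recon c = univ.image φ ∧ Function.Injective φ ∧
      (∀ e, (φ e).left = e.1.left) ∧ (∀ e, (φ e).right = e.1.right) ∧
      ∀ e e' x, e.1.Meets x → e'.1.Meets x → (c e < c e' ∨ c e = c e' ∧ e.1.ht x < e'.1.ht x) →
        (φ e).ht x < (φ e').ht x := by
  have hsub : ∀ j, colourClass c j ⊆ D := fun j e he => (mem_colourClass.1 he).1
  have hpre : ∀ j, IsPreWeb (colourClass c j) := fun j => hD.mono (hsub j)
  have hweb := fun j => (hpre j).isWebDiagram_rel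
  have hmem : ∀ e : D, e.1 ∈ colourClass c (c e) := fun e => mem_colourClass.2 ⟨e.2, rfl⟩
  obtain ⟨hR, -, hspec⟩ := iteratedSum_spec (fun j => rel (colourClass c j)) hweb
  -- The rank within the edge's own colour class, raised by the sizes of all smaller classes.
  let φ : D → Edge n := fun e =>
    (e.1.move fun x h => #{h' ∈ heightsOn (colourClass c (c e)) x | h' ≤ h}).shift
      fun x => ∑ m with m < c e, pegCount (rel (colourClass c m)) x
  have hφ : ∀ e, φ e ∈ summandEdges (fun j => rel (colourClass c j)) (c e) := fun e =>
    mem_summandEdges.2 ⟨_, mem_image_of_mem _ (hmem e), rfl⟩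
  have hlex : ∀ e e' x, e.1.Meets x → e'.1.Meets x →
      (c e < c e' ∨ c e = c e' ∧ e.1.ht x < e'.1.ht x) → (φ e).ht x < (φ e').ht x := by
    rintro e e' x hx hx' (hlt | ⟨heq, hlt⟩)
    · exact ht_lt_of_summand_lt hweb hlt (hφ e) (hφ e') hx hx'
    · simp only [φ]
      rw [Edge.ht_shift (e := e.1.move _) hx, Edge.ht_shift (e := e'.1.move _) hx',
        Edge.ht_move hx, Edge.ht_move hx', heq]
      exact Nat.add_lt_add_right (rank_lt (hpre _) (hmem e') hx' hlt) _
  refine ⟨hR, φ, ?_, fun e e' h => ?_, fun _ => rfl, fun _ => rfl, hlex⟩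
  · ext e
    rw [recon, hspec, mem_image]
    constructor
    · rintro ⟨j, hj⟩
      obtain ⟨e1, he1, rfl⟩ := mem_summandEdges.1 hj
      obtain ⟨e2, he2, rfl⟩ := mem_image.1 (rel_eq (colourClass c j) ▸ he1)
      obtain ⟨h2, rfl⟩ := mem_colourClass.1 he2
      exact ⟨⟨e2, h2⟩, mem_univ _, rfl⟩
    · rintro ⟨e, -, rfl⟩
      exact ⟨c e, hφ e⟩
  -- Edges with equal images share their left peg, where the colour-then-height order would separate
  -- distinct edges.
  · have hl : (φ e).left = (φ e').left := congrArg Edge.left h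
    have hx : e.1.Meets e.1.left := Or.inl rfl
    have hx' : e'.1.Meets e.1.left := Or.inl hl.symm
    have h1 := fun hh => (hlex e e' _ hx hx' hh).ne (by rw [h])
    have h2 := fun hh => (hlex e' e _ hx' hx hh).ne (by rw [h])
    simp only [not_or, not_and, imp_false, not_lt] at h1 h2
    have hc : c e = c e' := le_antisymm h2.1 h1.1
    exact Subtype.ext (hD.inj _ e.2 _ e'.2 _ hx hx'
      (le_antisymm (h2.2 hc.symm) (h1.2 hc)))

/-! ### Self-reconstructing colourings -/

/-- Colouring the summands by an order-preserving map is self-reconstructing. -/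
theorem recon_eq_self {k l : ℕ} {E : Fin k → Finset (Edge n)} (hE : ∀ i, IsWebDiagram (E i))
    {D : Finset (Edge n)} (hsum : D = iteratedSum E) {g : Fin k → Fin l}
    (hg : ∀ i j, IsBelow E i j → g i ≤ g j) {c : D → Fin l}
    (hc : ∀ i, ∀ e : D, e.1 ∈ summandEdges E i → c e = g i) : recon c = D := by
  obtain ⟨hD, -, hspec⟩ := iteratedSum_spec E hE
  rw [← hsum] at hD hspec
  obtain ⟨hR, φ, hφ, hinj, hl, hr, hlex⟩ := exists_recon_map hD.isPreWeb c
  have hDim : D = univ.image (Subtype.val : D → Edge n) := by simp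
  have key := IsWebDiagram.rigid (univ : Finset D) Subtype.val φ (hDim ▸ hD) (hφ ▸ hR)
    Subtype.val_injective.injOn hinj.injOn (fun e _ => (hl e).symm) (fun e _ => (hr e).symm)
    (fun e _ e' _ x hx hx' hlt => by
      refine hlex e e' x hx hx' ?_
      obtain ⟨i, hi⟩ := (hspec e.1).1 e.2
      obtain ⟨j, hj⟩ := (hspec e'.1).1 e'.2
      rw [hc i e hi, hc j e' hj]
      rcases lt_trichotomy i j with hij | rfl | hij
      · have := hg i j ((isBelow_iff hE).2 ⟨hij, _, hi, _, hj, x, hx, hx'⟩)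
        exact this.lt_or_eq.imp id fun h => ⟨h, hlt⟩
      · exact Or.inr ⟨rfl, hlt⟩
      · exact absurd (ht_lt_of_summand_lt hE hij hj hi hx' hx) hlt.asymm)
  rw [hφ]
  conv_rhs => rw [hDim]
  exact image_congr fun e he => (key e he).symm

/-- A function on the edges of `D` that weakly increases along every peg is constant on the
indecomposable summands. -/
theorem eq_of_mem_summandEdges {α : Type*} [LinearOrder α] {k : ℕ} {E : Fin k → Finset (Edge n)}
    (hE : ∀ i, IsWebDiagram (E i)) (hEind : ∀ i, ¬ IsDecomposable (E i))
    {D : Finset (Edge n)} (hsum : D = iteratedSum E) (f : D → α)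
    (hf : ∀ e e' : D, ∀ x, e.1.Meets x → e'.1.Meets x → e.1.ht x < e'.1.ht x → f e ≤ f e')
    {i : Fin k} {e e' : D} (he : e.1 ∈ summandEdges E i) (he' : e'.1 ∈ summandEdges E i) :
    f e = f e' := by
  have hspec := (iteratedSum_spec E hE).2.2
  rw [← hsum] at hspec
  set a : Fin n → ℕ := fun x => ∑ m with m < i, pegCount (E m) x
  have hmem : ∀ d ∈ E i, d.shift a ∈ D := fun d hd =>
    (hspec _).2 ⟨i, mem_summandEdges.2 ⟨d, hd, rfl⟩⟩
  -- `f e` is a dummy value, never taken on edges of `E i`.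
  let F : Edge n → α := fun d => if h : d.shift a ∈ D then f ⟨d.shift a, h⟩ else f e
  have hF : ∀ d (hd : d ∈ E i), F d = f ⟨d.shift a, hmem d hd⟩ := fun d hd => dif_pos _
  obtain ⟨d, hd, hde⟩ := mem_summandEdges.1 he
  obtain ⟨d', hd', hde'⟩ := mem_summandEdges.1 he'
  have := eq_of_not_isDecomposable (hE i) (hEind i) F (fun b hb b' hb' x hx hx' hlt => by
    rw [hF b hb, hF b' hb']
    refine hf _ _ x hx hx' ?_
    simp only
    rw [Edge.ht_shift hx, Edge.ht_shift hx']
    exact Nat.add_lt_add_right hlt _) hd hd'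
  rw [hF d hd, hF d' hd'] at this
  convert this using 2
  · exact Subtype.ext hde.symm
  · exact Subtype.ext hde'.symm

theorem image_unshift_summandEdges {k : ℕ} (E : Fin k → Finset (Edge n)) (i : Fin k) :
    (summandEdges E i).image (Edge.unshift fun x => ∑ m with m < i, pegCount (E m) x) = E i := by
  rw [summandEdges_eq, image_image]
  exact (image_congr (g := id) fun d _ => Edge.unshift_shift _ d).trans image_id

theorem unshift_injOn_summandEdges {k : ℕ} (E : Fin k → Finset (Edge n)) (i : Fin k) :
    Set.InjOn (Edge.unshift fun x => ∑ m with m < i, pegCount (E m) x) (summandEdges E i) := by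
  intro e he e' he' h
  obtain ⟨d, -, rfl⟩ := mem_summandEdges.1 he
  obtain ⟨d', -, rfl⟩ := mem_summandEdges.1 he'
  rw [Edge.unshift_shift, Edge.unshift_shift] at h
  rw [h]

/-- A self-reconstructing colouring is induced by an order-preserving map of the summands. -/
theorem exists_of_recon_eq_self {k l : ℕ} {E : Fin k → Finset (Edge n)}
    (hE : ∀ i, IsWebDiagram (E i)) (hEne : ∀ i, (E i).Nonempty)
    (hEind : ∀ i, ¬ IsDecomposable (E i)) (hdistinct : Function.Injective E)
    {D : Finset (Edge n)} (hsum : D = iteratedSum E) {c : D → Fin l} (hc : recon c = D) :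
    ∃ g : Fin k → Fin l, (∀ i j, IsBelow E i j → g i ≤ g j) ∧
      ∀ i, ∀ e : D, e.1 ∈ summandEdges E i → c e = g i := by
  obtain ⟨hD, -, hspec⟩ := iteratedSum_spec E hE
  rw [← hsum] at hD hspec
  obtain ⟨-, φ, hφ, hinj, hl, hr, hlex⟩ := exists_recon_map hD.isPreWeb c
  rw [hc] at hφ
  have hφD : ∀ e, φ e ∈ D := fun e => by rw [hφ]; exact mem_image_of_mem _ (mem_univ e)
  choose comp hcomp using fun e : D => (hspec e.1).1 e.2
  have hcomp_iff : ∀ (e : D) i, e.1 ∈ summandEdges E i ↔ comp e = i := fun e i =>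
    ⟨fun h => summand_unique hE (hcomp e) h, fun h => h ▸ hcomp e⟩
  have hrep : ∀ i, ∃ e : D, comp e = i := fun i => by
    obtain ⟨d, hd⟩ := hEne i
    have hd' := mem_summandEdges.2 ⟨d, hd, rfl⟩
    exact ⟨⟨_, (hspec _).2 ⟨i, hd'⟩⟩, (hcomp_iff _ i).1 hd'⟩
  choose r hr' using hrep
  let ψ : D → D := fun e => ⟨φ e, hφD e⟩
  have hψi : Function.Injective ψ := fun e e' h => hinj (congrArg Subtype.val h)
  let ψe : D ≃ D := Equiv.ofBijective ψ (Finite.injective_iff_bijective.1 hψi)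
  have hmeets : ∀ e x, (ψ e).1.Meets x ↔ e.1.Meets x := fun e x => by
    simp only [ψ, Edge.Meets, hl, hr]
  -- Along a peg the preimages are sorted by colour, and within a colour by old height, hence by
  -- summand; so `F` weakly increases.
  let F : D → Fin l ×ₗ Fin k := fun e => toLex (c (ψe.symm e), comp (ψe.symm e))
  have hF : ∀ e e' : D, comp e = comp e' → F e = F e' := fun e e' h =>
    eq_of_mem_summandEdges hE hEind hsum F (fun b b' x hx hx' hlt => by
      obtain ⟨b, rfl⟩ := ψe.surjective b
      obtain ⟨b', rfl⟩ := ψe.surjective b'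
      have hx1 := (hmeets b x).1 hx
      have hx1' := (hmeets b' x).1 hx'
      simp only [F, Equiv.symm_apply_apply]
      rw [Prod.Lex.toLex_le_toLex]
      have h1 : ¬ _ := fun h => (hlex b' b x hx1' hx1 h).asymm hlt
      simp only [not_or, not_and, not_lt] at h1
      refine h1.1.lt_or_eq.imp id fun heq => ⟨heq, ?_⟩
      by_contra hcc
      have h2 := ht_lt_of_summand_lt hE (not_le.1 hcc) (hcomp b') (hcomp b) hx1' hx1
      exact absurd (h1.2 heq.symm) (not_le.2 h2)) ((hcomp_iff e _).2 h) (hcomp e')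
  have hFψ : ∀ e, F (ψe e) = toLex (c e, comp e) := fun e => by
    simp only [F, Equiv.symm_apply_apply]
  -- The summand from which all edges of summand `i` come; by `hF` the representative is immaterial.
  let s : Fin k → Fin k := fun i => comp (ψe.symm (r i))
  have hs : ∀ e, s (comp (ψe e)) = comp e := fun e => by
    have := hF (r (comp (ψe e))) (ψe e) (hr' _)
    rw [hFψ] at this
    exact congrArg (fun p => (ofLex p).2) this
  have hs_surj : Function.Surjective s := fun j => ⟨comp (ψe (r j)), by rw [hs, hr']⟩
  have hs_inj : Function.Injective s := Finite.injective_iff_surjective.2 hs_surj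
  -- `ψ` carries summand `s i` onto summand `i`. The colour is constant there, so `ψ` keeps the
  -- order on every peg and rigidity applies.
  have hEs : ∀ i, E (s i) = E i := fun i => by
    let T : Finset D := {e | comp e = s i}
    have hT : ∀ e, e ∈ T ↔ comp e = s i := fun e => by simp [T]
    have hTψ : ∀ e, e ∈ T ↔ comp (ψe e) = i := fun e => by
      rw [hT, ← hs e, hs_inj.eq_iff]
    set a : Fin k → Fin n → ℕ := fun i x => ∑ m with m < i, pegCount (E m) x with ha
    have hu : T.image (fun e => e.1.unshift (a (s i))) = E (s i) := by
      rw [← image_unshift_summandEdges E (s i)]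
      ext d
      simp only [mem_image]
      constructor
      · rintro ⟨e, he, rfl⟩
        exact ⟨e.1, (hcomp_iff _ _).2 ((hT e).1 he), rfl⟩
      · rintro ⟨e, he, rfl⟩
        exact ⟨⟨e, (hspec e).2 ⟨_, he⟩⟩, (hT _).2 ((hcomp_iff _ _).1 he), rfl⟩
    have hv : T.image (fun e => (ψe e).1.unshift (a i)) = E i := by
      rw [← image_unshift_summandEdges E i]
      ext d
      simp only [mem_image]
      constructor
      · rintro ⟨e, he, rfl⟩
        exact ⟨(ψe e).1, (hcomp_iff _ _).2 ((hTψ e).1 he), rfl⟩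
      · rintro ⟨e, he, rfl⟩
        obtain ⟨e', he'⟩ := ψe.surjective ⟨e, (hspec e).2 ⟨_, he⟩⟩
        refine ⟨e', (hTψ _).2 ((hcomp_iff _ _).1 ?_), ?_⟩ <;> rw [he']
        exact he
    have hcT : ∀ e ∈ T, ∀ e' ∈ T, c e = c e' := fun e he e' he' => by
      have := hF (ψe e) (ψe e') (((hTψ e).1 he).trans ((hTψ e').1 he').symm)
      rw [hFψ, hFψ] at this
      exact congrArg (fun p => (ofLex p).1) this
    have key := IsWebDiagram.rigid T (fun e => e.1.unshift (a (s i)))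
      (fun e => (ψe e).1.unshift (a i)) (hu ▸ hE _) (hv ▸ hE _)
      (fun e he e' he' h => Subtype.ext (unshift_injOn_summandEdges E (s i)
        ((hcomp_iff _ _).2 ((hT e).1 he)) ((hcomp_iff _ _).2 ((hT e').1 he')) h))
      (fun e he e' he' h => ψe.injective (Subtype.ext (unshift_injOn_summandEdges E i
        ((hcomp_iff _ _).2 ((hTψ e).1 he)) ((hcomp_iff _ _).2 ((hTψ e').1 he')) h)))
      (fun e _ => (hl e).symm) (fun e _ => (hr e).symm)
      (fun e he e' he' x hx hx' hlt => by
        have hx1 := (hmeets e x).2 hx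
        have hx1' := (hmeets e' x).2 hx'
        rw [Edge.ht_unshift (e := e.1) hx, Edge.ht_unshift (e := e'.1) hx'] at hlt
        rw [Edge.ht_unshift (e := (ψe e).1) hx1, Edge.ht_unshift (e := (ψe e').1) hx1']
        have h1 : (ψe e).1.ht x < (ψe e').1.ht x :=
          hlex e e' x hx hx' (Or.inr ⟨hcT e he e' he', by omega⟩)
        have h2 := (summandEdges_bounds (hE i) ((hcomp_iff _ _).2 ((hTψ e).1 he)) hx1).1
        have h3 : a i x < (ψe e).1.ht x := h2
        omega)
    rw [← hu, ← hv]
    exact image_congr key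
  have hsid : ∀ i, s i = i := fun i => hdistinct (hEs i)
  have hcψ : ∀ e, comp (ψe e) = comp e := fun e => by rw [← hs e, hsid]
  have hcc : ∀ e e', comp e = comp e' → c e = c e' := fun e e' h => by
    have := hF (ψe e) (ψe e') (by rw [hcψ, hcψ, h])
    rw [hFψ, hFψ] at this
    exact congrArg (fun p => (ofLex p).1) this
  refine ⟨fun i => c (r i), fun i j hij => ?_, fun i e he => hcc _ _ ?_⟩
  · obtain ⟨hlt, e, he, e', he', x, hx, hx'⟩ := (isBelow_iff hE).1 hij
    let d : D := ⟨e, (hspec e).2 ⟨_, he⟩⟩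
    let d' : D := ⟨e', (hspec e').2 ⟨_, he'⟩⟩
    have hd : comp d = i := (hcomp_iff _ _).1 he
    have hd' : comp d' = j := (hcomp_iff _ _).1 he'
    change c (r i) ≤ c (r j)
    rw [hcc (r i) d (by rw [hr', hd]), hcc (r j) d' (by rw [hr', hd'])]
    by_contra hle
    have h1 : (ψe d').1.ht x < (ψe d).1.ht x := hlex d' d x hx' hx (Or.inl (not_le.1 hle))
    have h2 := ht_lt_of_summand_lt hE hlt ((hcomp_iff (ψe d) i).2 (by rw [hcψ, hd]))
      ((hcomp_iff (ψe d') j).2 (by rw [hcψ, hd'])) ((hmeets d x).2 hx) ((hmeets d' x).2 hx')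
    exact h1.asymm h2
  · rw [(hcomp_iff e i).1 he, hr']

/-! ### From colourings to order-preserving surjections -/

theorem orderPreserving_decompositionPoset_iff {k l : ℕ} {E : Fin k → Finset (Edge n)}
    {g : Fin k → Fin l} :
    OrderPreserving (decompositionPoset E) g ↔ ∀ i j, IsBelow E i j → g i ≤ g j := by
  refine ⟨fun h i j hij => h i j (Relation.ReflTransGen.single hij), fun h i j hij => ?_⟩
  have hij' : Relation.ReflTransGen (IsBelow E) i j := hij
  induction hij' with
  | refl => exact le_rfl
  | tail h1 h2 ih => exact (ih h1).trans (h _ _ h2)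

/-- Needed because the matrix entries stop at `#D`: all numbers of colours up to `k` are then
included. -/
theorem card_iteratedSum {k : ℕ} {E : Fin k → Finset (Edge n)} (hE : ∀ i, IsWebDiagram (E i))
    (hEne : ∀ i, (E i).Nonempty) : k ≤ #(iteratedSum E) := by
  have hspec := (iteratedSum_spec E hE).2.2
  choose d hd using hEne
  have hd' := fun i => mem_summandEdges.2 ⟨d i, hd i, rfl⟩
  have := card_le_card_of_injOn (s := (univ : Finset (Fin k)))
    (fun i => (d i).shift fun x => ∑ m with m < i, pegCount (E m) x)
    (fun i _ => (hspec _).2 ⟨i, hd' i⟩)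
    (fun i _ j _ hij => summand_unique hE (hd' i) (by
      have hij' : Edge.shift _ (d i) = Edge.shift _ (d j) := hij
      rw [hij']; exact hd' j))
  simpa using this

open Classical in
theorem card_colourings_self {k l : ℕ} {E : Fin k → Finset (Edge n)}
    (hE : ∀ i, IsWebDiagram (E i)) (hEne : ∀ i, (E i).Nonempty)
    {D : Finset (Edge n)} (hsum : D = iteratedSum E)
    (h : ∀ c : D → Fin l, (Function.Surjective c ∧ recon c = D) ↔
      ∃ g : Fin k → Fin l, Function.Surjective g ∧ OrderPreserving (decompositionPoset E) g ∧
        ∀ i, ∀ e : D, e.1 ∈ summandEdges E i → c e = g i) :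
    #(colourings D D l) = #{g : Fin k → Fin l |
      Function.Surjective g ∧ OrderPreserving (decompositionPoset E) g} := by
  have hspec := (iteratedSum_spec E hE).2.2
  rw [← hsum] at hspec
  choose comp hcomp using fun e : D => (hspec e.1).1 e.2
  have hcomp_eq : ∀ (e : D) i, e.1 ∈ summandEdges E i → comp e = i := fun e i h =>
    summand_unique hE (hcomp e) h
  have hsurj : Function.Surjective comp := fun i => by
    obtain ⟨d, hd⟩ := hEne i
    have hd' := mem_summandEdges.2 ⟨d, hd, rfl⟩
    exact ⟨⟨_, (hspec _).2 ⟨i, hd'⟩⟩, hcomp_eq _ i hd'⟩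
  symm
  refine card_bij (fun g _ => g ∘ comp) ?_ ?_ ?_
  · intro g hg
    obtain ⟨-, hg1, hg2⟩ := mem_filter.1 hg
    exact mem_filter.2 ⟨mem_univ _, (h _).2 ⟨g, hg1, hg2, fun i e he =>
      congrArg g (hcomp_eq e i he)⟩⟩
  · intro g _ g' _ hgg
    exact hsurj.injective_comp_right hgg
  · intro c hc
    obtain ⟨g, hg1, hg2, hg3⟩ := (h c).1 (mem_filter.1 hc).2
    exact ⟨g, mem_filter.2 ⟨mem_univ _, hg1, hg2⟩, funext fun e => (hg3 _ e (hcomp e)).symm⟩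

/-! ### Monotone surjections of chains and their jump sets -/

theorem card_jumps_lt_succ {q : ℕ} (S : Finset (Fin q)) (r : Fin q) :
    #{s ∈ S | s.castSucc < r.succ} =
      #{s ∈ S | s.castSucc < r.castSucc} + if r ∈ S then 1 else 0 := by
  have h : {s ∈ S | s.castSucc < r.succ} =
      {s ∈ S | s.castSucc < r.castSucc} ∪ {s ∈ S | s = r} := by
    ext s
    simp only [mem_filter, mem_union, Fin.lt_def, Fin.val_castSucc, Fin.val_succ, Fin.ext_iff]
    constructor
    · rintro ⟨h1, h2⟩
      rcases Nat.lt_succ_iff_lt_or_eq.1 h2 with h | h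
      · exact Or.inl ⟨h1, h⟩
      · exact Or.inr ⟨h1, h⟩
    · rintro (⟨h1, h2⟩ | ⟨h1, h2⟩)
      · exact ⟨h1, by omega⟩
      · exact ⟨h1, by omega⟩
  rw [h, card_union_of_disjoint, filter_eq']
  · split_ifs <;> simp
  · rw [disjoint_left]
    intro s hs hs'
    rw [(mem_filter.1 hs').2] at hs
    simp at hs

/-- A monotone surjection of finite chains takes at `i` the number of its jumps before `i`. -/
theorem monotone_surjective_apply {q l : ℕ} (h : Fin (q + 1) → Fin l) (hm : Monotone h)
    (hs : Function.Surjective h) (i : Fin (q + 1)) :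
    (h i : ℕ) = #{s ∈ ({s | h s.castSucc < h s.succ} : Finset (Fin q)) | s.castSucc < i} := by
  induction i using Fin.induction with
  | zero =>
    have : NeZero l := ⟨fun h0 => by subst h0; exact (h 0).elim0⟩
    obtain ⟨j, hj⟩ := hs 0
    have h1 : h 0 ≤ h j := hm (Fin.zero_le j)
    rw [hj] at h1
    have h2 : h 0 = 0 := le_antisymm h1 (Fin.zero_le _)
    simp [h2]
  | succ r ih =>
    rw [card_jumps_lt_succ, ← ih]
    simp only [mem_filter, mem_univ, true_and]
    have hle : h r.castSucc ≤ h r.succ := hm (Fin.castSucc_lt_succ).le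
    split_ifs with hlt
    · by_contra hne
      have hlt' : (h r.castSucc : ℕ) + 1 < h r.succ := by
        have : (h r.castSucc : ℕ) < h r.succ := hlt
        omega
      -- A jump by two or more would skip this value: it is too large for positions up to `r` and
      -- too small for later ones.
      obtain ⟨j, hj⟩ := hs ⟨h r.castSucc + 1, by omega⟩
      have hj' : (h j : ℕ) = h r.castSucc + 1 := by rw [hj]
      rcases le_or_gt j r.castSucc with hjr | hjr
      · have : (h j : ℕ) ≤ h r.castSucc := hm hjr
        omega
      · have : (h r.succ : ℕ) ≤ h j := hm (Fin.castSucc_lt_iff_succ_le.1 hjr)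
        omega
    · exact (congrArg Fin.val (le_antisymm hle (not_lt.1 hlt))).symm

/-- Discrete intermediate values: the count starts at 0 and grows by at most one per step. -/
theorem exists_card_jumps_eq {q : ℕ} (S : Finset (Fin q)) (m : ℕ) (hm : m ≤ #S) :
    ∃ i : Fin (q + 1), #{s ∈ S | s.castSucc < i} = m := by
  have key : ∀ i : Fin (q + 1), ∀ m ≤ #{s ∈ S | s.castSucc < i},
      ∃ j : Fin (q + 1), #{s ∈ S | s.castSucc < j} = m := by
    intro i
    induction i using Fin.induction with
    | zero => intro m hm; exact ⟨0, by simp at hm ⊢; omega⟩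
    | succ r ih =>
      intro m hm
      by_cases h : m ≤ #{s ∈ S | s.castSucc < r.castSucc}
      · exact ih m h
      · refine ⟨r.succ, ?_⟩
        rw [card_jumps_lt_succ] at hm ⊢
        split_ifs at hm ⊢ <;> omega
  refine key (Fin.last q) m (hm.trans_eq ?_)
  rw [filter_true_of_mem fun s _ => Fin.castSucc_lt_last s]

open Classical in
-- A monotone surjection is determined by its jump set, and l values require l - 1 jumps.
theorem card_monotone_surjective {q l : ℕ} (A : Finset (Fin q)) :
    #{h : Fin (q + 1) → Fin l | Monotone h ∧ Function.Surjective h ∧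
        ∀ r ∈ A, h r.castSucc < h r.succ} =
      #{S : Finset (Fin q) | A ⊆ S ∧ #S + 1 = l} := by
  refine card_bij' (fun h _ => ({s | h s.castSucc < h s.succ} : Finset (Fin q)))
    (fun S hS i => ⟨#{s ∈ S | s.castSucc < i}, by
      have h1 := (mem_filter.1 hS).2.2
      have h2 := card_le_card (filter_subset (fun s => s.castSucc < i) S)
      omega⟩) ?_ ?_ ?_ ?_
  · intro h hh
    obtain ⟨-, hm, hs, hA⟩ := mem_filter.1 hh
    refine mem_filter.2 ⟨mem_univ _, fun r hr => by simpa using hA r hr, ?_⟩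
    have h1 := monotone_surjective_apply h hm hs (Fin.last q)
    rw [filter_true_of_mem fun s _ => Fin.castSucc_lt_last s] at h1
    rw [← h1]
    have hl : 0 < l := (h 0).pos
    obtain ⟨j, hj⟩ := hs ⟨l - 1, by omega⟩
    have h2 : (h j : ℕ) ≤ h (Fin.last q) := hm (Fin.le_last j)
    rw [hj] at h2
    have := (h (Fin.last q)).2
    simp only at h2
    omega
  · intro S hS
    obtain ⟨-, hA, hc⟩ := mem_filter.1 hS
    refine mem_filter.2 ⟨mem_univ _, fun i j hij => ?_, fun m => ?_, fun r hr => ?_⟩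
    · exact card_le_card fun s hs => by
        simp only [mem_filter] at hs ⊢
        exact ⟨hs.1, hs.2.trans_le hij⟩
    · obtain ⟨i, hi⟩ := exists_card_jumps_eq S m (by have := m.2; omega)
      exact ⟨i, Fin.ext hi⟩
    · rw [Fin.lt_def]
      simp only
      rw [card_jumps_lt_succ, if_pos (hA hr)]
      omega
  · intro h hh
    obtain ⟨-, hm, hs, hA⟩ := mem_filter.1 hh
    funext i
    exact Fin.ext (monotone_surjective_apply h hm hs i).symm
  · intro S hS
    ext r
    simp only [mem_filter, mem_univ, true_and, Fin.lt_def]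
    have := card_jumps_lt_succ S r
    simp only [Fin.lt_def] at this
    rw [this]
    split_ifs with h <;> simp [h]

/-! ### Descents and linear extensions -/

/-- The positions of the descents of a word. -/
def descents {q : ℕ} (π : Equiv.Perm (Fin (q + 1))) : Finset (Fin q) :=
  {r | π r.succ < π r.castSucc}

theorem des_eq {q : ℕ} (π : Equiv.Perm (Fin (q + 1))) : des π = #(descents π) := by
  rw [des]
  refine Eq.trans (congrArg card ?_) (card_map Fin.castSuccEmb)
  ext i
  simp only [descents, mem_filter, mem_univ, true_and, mem_map, Fin.coe_castSuccEmb]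
  constructor
  · rintro ⟨h, hlt⟩
    exact ⟨⟨i, by omega⟩, hlt, rfl⟩
  · rintro ⟨r, hr, rfl⟩
    exact ⟨by simp, hr⟩

theorem lt_of_no_descent {q : ℕ} (f : Fin (q + 1) → Fin (q + 1)) (i j : Fin (q + 1)) (hij : i < j)
    (h : ∀ r : Fin q, i ≤ r.castSucc → r.succ ≤ j → f r.castSucc < f r.succ) : f i < f j := by
  induction j using Fin.induction with
  | zero => exact absurd hij (by simp)
  | succ r ih =>
    have hir : i ≤ r.castSucc := by
      simp only [Fin.lt_def, Fin.le_def, Fin.val_succ, Fin.val_castSucc] at hij ⊢; omega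
    have hlast := h r hir le_rfl
    rcases hir.lt_or_eq with hlt | rfl
    · exact (ih hlt fun s hs hs' => h s hs (hs'.trans (Fin.castSucc_lt_succ).le)).trans hlast
    · exact hlast

open Classical in
/-- The order-preserving surjections of a naturally labelled poset onto a chain, sorted by the linear
extension that lists the elements by value and then by label. -/
theorem card_orderPreserving {q l : ℕ} (le : Fin (q + 1) → Fin (q + 1) → Prop)
    (hP : ∀ a b, le a b → a ≤ b) :
    #{g : Fin (q + 1) → Fin l | Function.Surjective g ∧ ∀ a b, le a b → g a ≤ g b} =
      ∑ π : Equiv.Perm (Fin (q + 1)) with ∀ a b, le a b → π.symm a ≤ π.symm b,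
        #{S : Finset (Fin q) | descents π ⊆ S ∧ #S + 1 = l} := by
  have hmem : ∀ g ∈ ({g : Fin (q + 1) → Fin l | Function.Surjective g ∧ ∀ a b, le a b → g a ≤ g b} :
      Finset _), Tuple.sort g ∈
      ({π | ∀ a b, le a b → π.symm a ≤ π.symm b} : Finset (Equiv.Perm (Fin (q + 1)))) := by
    intro g hg
    obtain ⟨-, hs, ho⟩ := mem_filter.1 hg
    obtain ⟨h1, h2⟩ := Tuple.eq_sort_iff.1 (rfl : Tuple.sort g = Tuple.sort g)
    refine mem_filter.2 ⟨mem_univ _, fun a b hab => ?_⟩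
    -- If `b` were listed before `a`, then `g a = g b`, and the tie-break by label would give `b <
    -- a`, against the natural labelling.
    by_contra hlt
    rw [not_le] at hlt
    have h3 := h1 hlt.le
    simp only [Function.comp_apply, Equiv.apply_symm_apply] at h3
    have h4 := h2 _ _ hlt (by simpa using le_antisymm h3 (ho a b hab))
    simp only [Equiv.apply_symm_apply] at h4
    exact absurd (hP a b hab) (not_le.2 h4)
  rw [card_eq_sum_card_fiberwise hmem]
  refine sum_congr rfl fun π hπ => ?_
  have hπ' := (mem_filter.1 hπ).2
  rw [← card_monotone_surjective]
  refine card_bij' (fun g _ => g ∘ π) (fun h _ => h ∘ π.symm) ?_ ?_ ?_ ?_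
  · intro g hg
    obtain ⟨h_g, rfl⟩ := mem_filter.1 hg
    obtain ⟨-, hs, ho⟩ := mem_filter.1 h_g
    obtain ⟨h1, h2⟩ := Tuple.eq_sort_iff.1 (rfl : Tuple.sort g = Tuple.sort g)
    refine mem_filter.2 ⟨mem_univ _, h1, hs.comp (Equiv.surjective _), fun r hr => ?_⟩
    have hr' := (mem_filter.1 hr).2
    refine lt_of_le_of_ne (h1 (Fin.castSucc_lt_succ).le) fun heq => ?_
    exact absurd (h2 _ _ Fin.castSucc_lt_succ heq) (not_lt.2 hr'.le)
  · intro h hh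
    obtain ⟨-, hm, hs, hA⟩ := mem_filter.1 hh
    refine mem_filter.2 ⟨mem_filter.2 ⟨mem_univ _, hs.comp (Equiv.surjective _), ?_⟩, ?_⟩
    · exact fun a b hab => hm (hπ' a b hab)
    · symm
      refine Tuple.eq_sort_iff.2 ⟨?_, fun i j hij heq => ?_⟩
      · simpa [Function.comp_assoc] using hm
      · simp only [Function.comp_apply, Equiv.symm_apply_apply] at heq
        -- A descent forces a jump of `h`, so labels increase along a block of equal values, as the
        -- tie-break of `Tuple.sort` demands.
        refine lt_of_no_descent π i j hij fun r hir hrj => ?_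
        by_contra hlt
        have hne : π r.succ ≠ π r.castSucc := fun h =>
          (Fin.castSucc_lt_succ (i := r)).ne' (π.injective h)
        have h1 := hA r (by simpa [descents] using lt_of_le_of_ne (not_lt.1 hlt) hne)
        have h2 := hm hir
        have h3 := hm hrj
        exact absurd (heq ▸ (h2.trans_lt h1).trans_le h3) (lt_irrefl _)
  · intro g _
    funext i; simp
  · intro h _
    funext i; simp

/-! ### Weighted sums and binomial identities -/

open Classical in
-- Write S as the disjoint union of A and T, and group by the size of T. Since #S + 1 ≤ q + 1 ≤ N,
-- no S is lost by stopping at N.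
theorem sum_weight_superset {R : Type*} [CommSemiring R] {q N : ℕ} (hN : q + 1 ≤ N) (w : ℕ → R)
    (A : Finset (Fin q)) :
    ∑ l ∈ Icc 1 N, w l * ((#{S : Finset (Fin q) | A ⊆ S ∧ #S + 1 = l} : ℕ) : R) =
      ∑ m ∈ range (q - #A + 1), ((q - #A).choose m : R) * w (1 + #A + m) := by
  have h1 : ∑ l ∈ Icc 1 N, w l * ((#{S : Finset (Fin q) | A ⊆ S ∧ #S + 1 = l} : ℕ) : R) =
      ∑ S : Finset (Fin q) with A ⊆ S, w (#S + 1) := by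
    rw [← sum_fiberwise_of_maps_to (s := ({S | A ⊆ S} : Finset (Finset (Fin q))))
      (t := Icc 1 N) (g := fun S => #S + 1)]
    · refine sum_congr rfl fun l _ => ?_
      rw [filter_filter, sum_congr rfl (g := fun _ => w l), sum_const, nsmul_eq_mul, mul_comm]
      intro S hS
      rw [(mem_filter.1 hS).2.2]
    · intro S _
      have := card_le_univ S
      rw [Fintype.card_fin] at this
      exact mem_Icc.2 ⟨by omega, by omega⟩
  have h2 : ∑ S : Finset (Fin q) with A ⊆ S, w (#S + 1) =
      ∑ T ∈ Aᶜ.powerset, w (1 + #A + #T) := by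
    refine sum_bij' (fun S _ => S \ A) (fun T _ => A ∪ T) ?_ ?_ ?_ ?_ ?_
    · intro S _
      rw [mem_powerset]
      intro r hr
      simpa using (mem_sdiff.1 hr).2
    · intro T _
      simp
    · intro S hS
      exact union_sdiff_of_subset (mem_filter.1 hS).2
    · intro T hT
      have hd : Disjoint T A := by
        rw [disjoint_left]
        intro r hr
        simpa using mem_powerset.1 hT hr
      rw [union_sdiff_left, sdiff_eq_self_of_disjoint hd]
    · intro S hS
      have hS' := (mem_filter.1 hS).2
      have := card_sdiff_add_card_eq_card hS'
      congr 1
      omega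
  rw [h1, h2, sum_powerset_apply_card (fun m => w (1 + #A + m)), card_compl, Fintype.card_fin]
  simp only [nsmul_eq_mul]

open Classical in
/-- Every weighted sum over the order-preserving surjections onto chains is a sum over the linear
extensions. -/
theorem sum_weight_orderPreserving {R : Type*} [CommSemiring R] {q N : ℕ} (hN : q + 1 ≤ N)
    (w : ℕ → R) (le : Fin (q + 1) → Fin (q + 1) → Prop)
    (hP : ∀ a b, le a b → a ≤ b) :
    ∑ l ∈ Icc 1 N, w l *
        ((#{g : Fin (q + 1) → Fin l | Function.Surjective g ∧ ∀ a b, le a b → g a ≤ g b} : ℕ) : R) =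
      ∑ π : Equiv.Perm (Fin (q + 1)) with ∀ a b, le a b → π.symm a ≤ π.symm b, ∑ m ∈ range (q - des π + 1),
        ((q - des π).choose m : R) * w (1 + des π + m) := by
  simp only [card_orderPreserving le hP, Nat.cast_sum, mul_sum]
  rw [sum_comm]
  refine sum_congr rfl fun π _ => ?_
  rw [des_eq, ← sum_weight_superset hN w]

theorem sum_choose_mul_pow {R : Type*} [CommSemiring R] (x : R) (N d : ℕ) :
    ∑ m ∈ range (N + 1), (N.choose m : R) * x ^ (1 + d + m) = x ^ (1 + d) * (1 + x) ^ N := by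
  rw [add_comm 1 x, add_pow, mul_sum]
  refine sum_congr rfl fun m _ => ?_
  rw [one_pow, pow_add x (1 + d) m]
  ring

/-- Both sides equal the Beta integral of t^d (1-t)^N over [0,1]. The induction uses t^d (1-t)^(N+1)
= t^d (1-t)^N - t^(d+1) (1-t)^N, which on the sums is Pascal's rule. -/
theorem sum_choose_mul_alternating (N d : ℕ) :
    ∑ m ∈ range (N + 1), (N.choose m : ℚ) * ((-1) ^ m / ((d + m + 1 : ℕ) : ℚ)) =
      1 / (((N + d + 1 : ℕ) : ℚ) * ((N + d).choose d : ℚ)) := by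
  induction N generalizing d with
  | zero => simp
  | succ N ih =>
    have hrec : ∑ m ∈ range (N + 1 + 1),
        ((N + 1).choose m : ℚ) * ((-1) ^ m / ((d + m + 1 : ℕ) : ℚ)) =
        ∑ m ∈ range (N + 1), (N.choose m : ℚ) * ((-1) ^ m / ((d + m + 1 : ℕ) : ℚ)) -
        ∑ m ∈ range (N + 1), (N.choose m : ℚ) * ((-1) ^ m / ((d + 1 + m + 1 : ℕ) : ℚ)) := by
      rw [sum_range_succ' _ (N + 1)]
      -- Append the vanishing term m = N + 1, then split off m = 0.
      have h1 : ∑ m ∈ range (N + 1),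
          (N.choose m : ℚ) * ((-1) ^ m / ((d + m + 1 : ℕ) : ℚ)) =
          ∑ m ∈ range (N + 1),
            (N.choose (m + 1) : ℚ) * ((-1) ^ (m + 1) / ((d + (m + 1) + 1 : ℕ) : ℚ)) +
          (N.choose 0 : ℚ) * ((-1) ^ 0 / ((d + 0 + 1 : ℕ) : ℚ)) := by
        rw [← sum_range_succ' (fun m => (N.choose m : ℚ) * ((-1) ^ m / ((d + m + 1 : ℕ) : ℚ))),
          sum_range_succ _ (N + 1)]
        simp
      rw [h1, add_sub_right_comm, ← sum_sub_distrib]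
      congr 1
      · refine sum_congr rfl fun m _ => ?_
        rw [Nat.choose_succ_succ, show d + 1 + m + 1 = d + (m + 1) + 1 by ring]
        push_cast
        ring
      · simp
    rw [hrec, ih d, ih (d + 1)]
    have e1 : (((N + d + 1).choose (d + 1) : ℕ) : ℚ) * ((d + 1 : ℕ) : ℚ) =
        ((N + d + 1 : ℕ) : ℚ) * ((N + d).choose d : ℚ) := by
      exact_mod_cast (Nat.add_one_mul_choose_eq (N + d) d).symm
    have e2 : (((N + d + 1).choose d : ℕ) : ℚ) * ((N + 1 : ℕ) : ℚ) =
        ((N + d + 1 : ℕ) : ℚ) * ((N + d).choose d : ℚ) := by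
      have := Nat.choose_mul_succ_eq (N + d) d
      rw [show N + d + 1 - d = N + 1 by omega] at this
      rw [mul_comm ((N + d + 1 : ℕ) : ℚ)]
      exact_mod_cast this.symm
    have hc0 : ((N + d).choose d : ℚ) ≠ 0 :=
      Nat.cast_ne_zero.2 (Nat.choose_pos (by omega)).ne'
    rw [show N + (d + 1) = N + d + 1 by ring, show N + 1 + d = N + d + 1 by ring]
    rw [eq_div_of_mul_eq (by positivity) e1, eq_div_of_mul_eq (by positivity) e2]
    field_simp
    push_cast
    ring

end Web

/-! ### The diagonal entries -/

theorem theorem3p3 {n k : ℕ} (D₀ D : Finset (Web.Edge n)) (hD₀ : Web.IsWebDiagram D₀)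
    (hD : D ∈ Web.webWorld D₀) (hne : D.Nonempty)
    (E : Fin k → Finset (Web.Edge n)) (hE : ∀ i, Web.IsWebDiagram (E i))
    (hEne : ∀ i, (E i).Nonempty) (hEind : ∀ i, ¬ Web.IsDecomposable (E i))
    (hsum : D = Web.iteratedSum E) (hdistinct : Function.Injective E) :
    Web.webColouringMatrix (Web.webWorld D₀) ⟨D, hD⟩ ⟨D, hD⟩ =
        ∑ π ∈ Web.jordanHolderSet (Web.decompositionPoset E),
          Polynomial.X ^ (1 + Web.des π) * (1 + Polynomial.X) ^ (k - 1 - Web.des π) ∧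
      Web.webMixingMatrix (Web.webWorld D₀) ⟨D, hD⟩ ⟨D, hD⟩ =
        ∑ π ∈ Web.jordanHolderSet (Web.decompositionPoset E),
          (-1 : ℚ) ^ Web.des π / ((k : ℚ) * ((k - 1).choose (Web.des π) : ℚ)) ∧
      ∀ (l : ℕ) (c : D → Fin l),
        (Function.Surjective c ∧ Web.recon c = D) ↔
          ∃ g : Fin k → Fin l, Function.Surjective g ∧
            Web.OrderPreserving (Web.decompositionPoset E) g ∧
            ∀ i, ∀ e : D, e.1 ∈ Web.summandEdges E i → c e = g i := by
  classical
  have hspec := (Web.iteratedSum_spec E hE).2.2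
  rw [← hsum] at hspec
  have hself : ∀ (l : ℕ) (c : D → Fin l),
      (Function.Surjective c ∧ Web.recon c = D) ↔
        ∃ g : Fin k → Fin l, Function.Surjective g ∧
          Web.OrderPreserving (Web.decompositionPoset E) g ∧
          ∀ i, ∀ e : D, e.1 ∈ Web.summandEdges E i → c e = g i := by
    intro l c
    simp only [Web.orderPreserving_decompositionPoset_iff]
    constructor
    · rintro ⟨hcs, hc⟩
      obtain ⟨g, hg, hcg⟩ := Web.exists_of_recon_eq_self hE hEne hEind hdistinct hsum hc
      refine ⟨g, fun j => ?_, hg, hcg⟩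
      obtain ⟨e, rfl⟩ := hcs j
      obtain ⟨i, hi⟩ := (hspec e.1).1 e.2
      exact ⟨i, (hcg i e hi).symm⟩
    · rintro ⟨g, hgs, hg, hcg⟩
      refine ⟨fun j => ?_, Web.recon_eq_self hE hsum hg hcg⟩
      obtain ⟨i, rfl⟩ := hgs j
      obtain ⟨d, hd⟩ := hEne i
      have hd' := Web.mem_summandEdges.2 ⟨d, hd, rfl⟩
      exact ⟨⟨_, (hspec _).2 ⟨i, hd'⟩⟩, hcg i _ hd'⟩
  have hk : k ≤ #D := hsum ▸ Web.card_iteratedSum hE hEne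
  obtain ⟨q, rfl⟩ : ∃ q, k = q + 1 := by
    obtain ⟨e, he⟩ := hne
    obtain ⟨i, -⟩ := (hspec e).1 he
    exact ⟨k - 1, by have := i.pos; omega⟩
  have hJ : Web.jordanHolderSet (Web.decompositionPoset E) =
      ({π | ∀ a b, Relation.ReflTransGen (Web.IsBelow E) a b → π.symm a ≤ π.symm b} :
        Finset (Equiv.Perm (Fin (q + 1)))) := by
    ext π
    simp only [Web.jordanHolderSet, mem_filter]
    rfl
  have hcol : ∀ l, #(Web.colourings D D l) = #{g : Fin (q + 1) → Fin l |
      Function.Surjective g ∧ ∀ a b, Relation.ReflTransGen (Web.IsBelow E) a b → g a ≤ g b} :=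
    fun l => by
      rw [Web.card_colourings_self hE hEne hsum (hself l)]
      congr 1
      ext g
      simp only [mem_filter]
      rfl
  have hdes : ∀ π : Equiv.Perm (Fin (q + 1)), Web.des π ≤ q := fun π => by
    rw [Web.des_eq]
    simpa using card_le_univ (Web.descents π)
  refine ⟨?_, ?_, hself⟩
  · rw [hJ, Nat.add_sub_cancel]
    simp only [Web.webColouringMatrix, hcol]
    rw [Web.sum_weight_orderPreserving hk (fun l => Polynomial.X ^ l) _
      fun _ _ => Web.le_of_reflTransGen_isBelow E]
    exact sum_congr rfl fun π _ => Web.sum_choose_mul_pow _ _ _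
  · rw [hJ, Nat.add_sub_cancel]
    simp only [Web.webMixingMatrix, hcol]
    rw [Web.sum_weight_orderPreserving hk (fun l => (-1 : ℚ) ^ (l - 1) / (l : ℚ)) _
      fun _ _ => Web.le_of_reflTransGen_isBelow E]
    refine sum_congr rfl fun π _ => ?_
    -- The sign (-1)^(l-1) with l = 1 + des π + m splits as (-1)^(des π) (-1)^m, leaving this sum.
    have h := Web.sum_choose_mul_alternating (q - Web.des π) (Web.des π)
    rw [Nat.sub_add_cancel (hdes π)] at h
    rw [div_eq_mul_one_div, ← h, mul_sum]
    refine sum_congr rfl fun m _ => ?_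
    rw [show 1 + Web.des π + m - 1 = Web.des π + m by omega,
      show 1 + Web.des π + m = Web.des π + m + 1 by omega, pow_add]
    ring
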